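/- Let $\mathcal A$ be a unital JB-algebra, that is, a real Jordan algebra with unit $I$ (commutative bilinear product $\circ$ with $(a^2\circ b)\circ a=a^2\circ(b\circ a)$), complete in a norm with $\|a\circ b\|\le\|a\|\,\|b\|$, $\|a^2\|=\|a\|^2$ and $\|a^2\|\le\|a^2+b^2\|$ for all $a,b$. An element $a$ is invertible if there is $b$ (unique, denoted $a^{-1}$) with $a\circ b=I$ and $a^2\circ b=a$; its spectrum is the set of $r\in\mathbb R$ such that $a-rI$ is not invertible; $a$ is positive if its spectrum lies in $[0,\infty)$; functions such as $a^{r}$ are defined by continuous functional calculus on the spectrum. Put $\{aba\}:=2(a\circ b)\circ a-a^2\circ b$. For positive invertible $A,B\in\mathcal A$ define $$A\#_\lambda B:=\left\{A^{\frac12}\{A^{-\frac12}BA^{-\frac12}\}^{\lambda}A^{\frac12}\right\},\qquad T_\lambda(A|B):=\frac{A\#_\lambda B-A}{\lambda},\qquad A\,!_t\,B:=\left((1-t)A^{-1}+tB^{-1}\right)^{-1}.$$ **Theorem.** Let $A,B$ be positive invertible elements of a unital JB-algebra $\mathcal A$ and let $\lambda\in(0,1)$. Then the function $t\mapsto\left(\frac{t}{1-t}\right)^{\lambda}\frac{A\,!_t\,B-A}{t}$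 is (Bochner) integrable on $(0,1)$ with values in $\mathcal A$, and $$T_\lambda(A|B)=\frac{\sin(\lambda\pi)}{\lambda\pi}\int_0^1\left(\frac{t}{1-t}\right)^{\lambda}\frac{A\,!_t\,B-A}{t}\,dt .$$ -/

import Mathlib

open MeasureTheory

noncomputable section

namespace JB

/-- A normed, possibly nonassociative, commutative ring with unit: the ring structure and the
norm share one additive group structure. -/
class NormedNonAssocCommRing (A : Type*) extends NonAssocCommRing A, NormedAddCommGroup A where

/-- A unital JB-algebra: a real unital Jordan algebra (a commutative bilinear product satisfying
the Jordan identity `IsCommJordan`) with a complete norm that satisfies the three JB conditions. -/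
class UnitalJBAlgebra (A : Type*) [NormedNonAssocCommRing A] [NormedSpace ℝ A] : Prop extends
    IsScalarTower ℝ A A, SMulCommClass ℝ A A, IsCommJordan A, CompleteSpace A where
  norm_mul_le : ∀ a b : A, ‖a * b‖ ≤ ‖a‖ * ‖b‖
  norm_sq : ∀ a : A, ‖a * a‖ = ‖a‖ ^ 2
  norm_sq_le : ∀ a b : A, ‖a * a‖ ≤ ‖a * a + b * b‖

variable {A : Type*} [NormedNonAssocCommRing A] [NormedSpace ℝ A]

/-- `b` is a Jordan inverse of `a`. -/
def IsInverse (a b : A) : Prop := a * b = 1 ∧ (a * a) * b = a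

/-- `a` is invertible in the Jordan sense. -/
def IsInvertible (a : A) : Prop := ∃ b : A, IsInverse a b

open Classical in
/-- The Jordan inverse of `a` (equal to `0` if `a` is not invertible). -/
def inverse (a : A) : A := if h : IsInvertible a then h.choose else 0

/-- The (real) spectrum of `a`. -/
def spec (a : A) : Set ℝ := {r : ℝ | ¬ IsInvertible (a - r • (1 : A))}

/-- `a` is positive: its spectrum is contained in `[0, ∞)`. -/
def Positive (a : A) : Prop := spec a ⊆ Set.Ici 0

/-- The quadratic map `U_a b = {a b a}`. -/
def U (a b : A) : A := (2 : ℝ) • ((a * b) * a) - (a * a) * b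

/-- `Φ` is the continuous functional calculus of `a`: the continuous unital homomorphism of real
(Jordan) algebras from `C(spec a, ℝ)` to `A` that sends the identity function to `a`. -/
structure IsFunctionalCalculus (a : A) (Φ : C(spec a, ℝ) →ₗ[ℝ] A) : Prop where
  map_one : Φ 1 = 1
  map_mul : ∀ f g : C(spec a, ℝ), Φ (f * g) = Φ f * Φ g
  map_id : Φ ⟨fun x => (x : ℝ), continuous_subtype_val⟩ = a
  continuous : Continuous Φ

open Classical in
/-- `f(a)`, by continuous functional calculus, for a function `f` that is continuous on the
spectrum of `a` (the value `0` is used when `f` is not). -/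
def fc (f : ℝ → ℝ) (a : A) : A :=
  if h : (∃ Φ : C(spec a, ℝ) →ₗ[ℝ] A, IsFunctionalCalculus a Φ) ∧ ContinuousOn f (spec a) then
    h.1.choose ⟨(spec a).domRestrict f, continuousOn_iff_continuous_domRestrict.mp h.2⟩
  else 0

/-- The real power `a ^ r`, by functional calculus. -/
def power (a : A) (r : ℝ) : A := fc (fun x => x ^ r) a

/-- The weighted harmonic mean `A !_t B`. -/
def harmonicMean (t : ℝ) (a b : A) : A :=
  inverse ((1 - t) • inverse a + t • inverse b)

/-- The weighted geometric mean `A #_s B`. -/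
def geometricMean (s : ℝ) (a b : A) : A :=
  U (power a (1 / 2)) (power (U (power a (-(1 / 2))) b) s)

/-- The Tsallis relative operator entropy `T_s(A|B)`. -/
def tsallisEntropy (s : ℝ) (a b : A) : A := s⁻¹ • (geometricMean s a b - a)

end JB

end

/-!
The identity is a scalar integral, evaluated in the functional calculus of `c = U_{A^{-1/2}} B` and
transported by the bounded operator `U_{A^{1/2}}`. Since `A = U_{A^{1/2}} 1`,
`B = U_{A^{1/2}} c` and `(U_x y)⁻¹ = U_{x⁻¹} y⁻¹`, the harmonic mean `A !_t B` is `U_{A^{1/2}}` of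
the function `x / ((1 - t) x + t)` of `c` (`inv_smul_harmonicMean_sub`). The integrand is therefore
the image of `(t / (1 - t)) ^ s • (x - 1) / ((1 - t) x + t)`, a function of `t` with values
in `C(spec c, ℝ)` that is a continuous function times an integrable weight. Its integral is computed
pointwise: the substitution `v = t / ((1 - t) x + t)` and the Beta integral give
`π / sin (π s) * (x ^ s - 1)` (`integral_div_one_sub_rpow_mul`).

Three facts on JB-algebras carry this.

* The fundamental formula `U_{U_x y} = U_x U_y U_x` (`triple_fundamental`). Multiplications act on
  the triple product `{x y z}` as a structure algebra, which gives the five-linear identity of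
  Jordan triple systems, and the fundamental formula is a consequence of that identity. It follows
  that `a` is Jordan invertible exactly when the operator `U_a` is invertible, and that inversion
  intertwines `U_x` and `U_{x⁻¹}`.
* The continuous functional calculus (`exists_isFunctionalCalculus`). Powers of `a` generate an
  associative closed subalgebra, a real commutative Banach algebra with
  `‖x²‖ = ‖x‖² ≤ ‖x² + y²‖`. In such an algebra `1 - x` is a square for `‖x‖ < 1`, and the open
  cone `⋃ K, ball (K • 1) K` plays the role of the positive invertible elements. A positive element
  by which multiplication is bounded below lies in this cone, so the norm of `x` is at most `M` as
  soon as multiplication by `r - x` is bounded below for `|r| > M`. Jordan invertible elements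
  are bounded below because of `U_{b} U_{x} = 1`; factoring polynomials over `ℝ` yields
  `‖p(a)‖ ≤ sup |p|` on the Jordan spectrum (`norm_polyEval_le`), and the calculus arises by
  density.
* For invertible `x` the operator `U_x` preserves positive invertible elements (`StrictPos.U`), by
  connectedness of the segment from `1` to `y`. This makes `c` positive and invertible.
-/

namespace JB

/-! ### The Jordan triple product -/

section TripleProduct

variable {J : Type*} [NonAssocCommRing J]

/-- The Jordan triple product `{x y z} = (x y) z + x (y z) - y (x z)`. -/
def triple (x y z : J) : J := (x * y) * z + x * (y * z) - y * (x * z)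

theorem triple_comm (x y z : J) : triple x y z = triple z y x := by
  simp only [triple, mul_comm]
  abel

theorem triple_add_left (x x' y z : J) : triple (x + x') y z = triple x y z + triple x' y z := by
  simp only [triple, add_mul, mul_add]; abel

theorem triple_sub_left (x x' y z : J) : triple (x - x') y z = triple x y z - triple x' y z := by
  simp only [triple, sub_mul, mul_sub]; abel

theorem triple_add_middle (x y y' z : J) :
    triple x (y + y') z = triple x y z + triple x y' z := by
  simp only [triple, add_mul, mul_add]; abel

theorem triple_sub_middle (x y y' z : J) :
    triple x (y - y') z = triple x y z - triple x y' z := by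
  simp only [triple, sub_mul, mul_sub]; abel

theorem triple_add_right (x y z z' : J) : triple x y (z + z') = triple x y z + triple x y z' := by
  simp only [triple, mul_add]; abel

theorem triple_sub_right (x y z z' : J) : triple x y (z - z') = triple x y z - triple x y z' := by
  simp only [triple, mul_sub]; abel

end TripleProduct

/-! ### The five-linear identity and the fundamental formula -/

section JordanIdentities

variable {J : Type*} [NonAssocCommRing J] [Module ℝ J] [IsCommJordan J]

/-- The Jordan identity `(b a²) a = (b a) a²`, fully linearized. -/
theorem mul_mul_mul_cyclic (a b c d : J) :
    a * ((b * c) * d) + b * ((c * a) * d) + c * ((a * b) * d) =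
      (b * c) * (a * d) + (c * a) * (b * d) + (a * b) * (c * d) := by
  have h : (2 : ℕ) • (a * ((b * c) * d) - (b * c) * (a * d) +
      (b * ((c * a) * d) - (c * a) * (b * d)) + (c * ((a * b) * d) - (a * b) * (c * d))) = 0 :=
    DFunLike.congr_fun (two_nsmul_lie_lmul_lmul_add_add_eq_zero a b c) d
  have h2 : (2 : ℝ) • (a * ((b * c) * d) + b * ((c * a) * d) + c * ((a * b) * d) -
      ((b * c) * (a * d) + (c * a) * (b * d) + (a * b) * (c * d))) = 0 := by
    rw [← h]
    module
  rw [smul_eq_zero_iff_right two_ne_zero] at h2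
  exact sub_eq_zero.mp h2

theorem mul_mul_mul_swap (a b c d : J) :
    a * ((b * c) * d) + b * ((c * a) * d) + c * ((a * b) * d) =
      d * ((b * c) * a) + b * ((c * d) * a) + c * ((d * b) * a) := by
  have h1 := mul_mul_mul_cyclic a b c d
  have h2 := mul_mul_mul_cyclic d b c a
  rw [h1, h2]
  simp only [mul_comm]
  abel

/-- Commutators of multiplications are derivations: `[L_c, [L_x, L_y]] = L_u` with
`u = -[L_x, L_y] c`. -/
theorem lie_lie_mul (c x y z : J) :
    c * (x * (y * z)) - c * (y * (x * z)) - x * (y * (c * z)) + y * (x * (c * z)) =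
      ((c * x) * y) * z - (x * (c * y)) * z := by
  have h1 := mul_mul_mul_swap c y z x
  have h2 := mul_mul_mul_swap c x z y
  simp only [mul_comm] at h1 h2 ⊢
  linear_combination (norm := abel) h1 - h2

/-- Multiplications act on the triple product as elements of the structure algebra. -/
theorem mul_triple (c x y z : J) :
    c * triple x y z = triple (c * x) y z - triple x (c * y) z + triple x y (c * z) := by
  have h1 := mul_mul_mul_cyclic c x y z
  have h2 := lie_lie_mul c x y z
  simp only [triple, mul_add, mul_sub]
  simp only [mul_comm] at h1 h2 ⊢
  linear_combination (norm := abel) h1 + h2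

/-- The five-linear identity of Jordan triple systems. -/
theorem triple_triple (a b x y z : J) :
    triple a b (triple x y z) =
      triple (triple a b x) y z - triple x (triple b a y) z + triple x y (triple a b z) := by
  rw [show triple a b (triple x y z) =
    (a * b) * triple x y z + a * (b * triple x y z) - b * (a * triple x y z) from rfl]
  rw [show triple a b x = (a * b) * x + a * (b * x) - b * (a * x) from rfl,
    show triple b a y = (a * b) * y + b * (a * y) - a * (b * y) by rw [mul_comm a b]; rfl,
    show triple a b z = (a * b) * z + a * (b * z) - b * (a * z) from rfl]
  simp only [mul_triple, mul_add, mul_sub, triple_add_left, triple_sub_left, triple_add_middle,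
    triple_sub_middle, triple_add_right, triple_sub_right]
  abel

theorem triple_triple_self (x y z : J) :
    triple x y (triple x z x) = triple x (triple y x z) x ∧
      triple x z (triple x y x) = triple x (triple y x z) x := by
  have h1 := triple_triple x y x z x
  have h2 := triple_triple x z x y x
  rw [triple_comm (triple x y x) z x] at h1
  rw [triple_comm (triple x z x) y x, triple_comm z x y] at h2
  -- the two instances determine both unknowns since `3` is invertible
  have h3 : (3 : ℝ) • (triple x y (triple x z x) - triple x (triple y x z) x) = 0 := by
    linear_combination (norm := module) -h1 - (2 : ℝ) • h2
  have h4 : triple x y (triple x z x) = triple x (triple y x z) x :=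
    sub_eq_zero.mp ((smul_eq_zero_iff_right three_ne_zero).mp h3)
  refine ⟨h4, ?_⟩
  rw [h4] at h2
  linear_combination (norm := module) h2

theorem triple_triple_left (x y z : J) :
    triple (triple x y x) y z = triple x (triple y x y) z := by
  have h := triple_triple x y x y z
  linear_combination (norm := abel) -h

/-- The fundamental formula `U_{U_x y} z = U_x U_y U_x z`, where `U_x y = {x y x}`. -/
theorem triple_fundamental (x y z : J) :
    triple (triple x y x) z (triple x y x) =
      triple x (triple y (triple x z x) y) x := by
  have h1 := triple_triple (triple x y x) z x y x
  have h2 : triple (triple x y x) z x = triple x (triple y x z) x := by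
    rw [triple_comm, (triple_triple_self x y z).2]
  have h3 : triple z (triple x y x) y = triple (triple y x y) x z := by
    rw [triple_comm, triple_triple_left]
  have h4 := triple_triple z x y x y
  have h5 := (triple_triple_self x y (triple y x z)).1
  rw [triple_comm z x (triple y x y), triple_comm z x y, triple_comm (triple y x z) x y,
    triple_comm x z x] at h4
  rw [h2, h3, triple_comm (triple x (triple y x z) x) y x, h5] at h1
  rw [h1]
  have h6 : triple y (triple x z x) y = triple y x (triple y x z) + triple y x (triple y x z)
      - triple (triple y x y) x z := by
    linear_combination (norm := abel) h4
  rw [h6, triple_sub_middle, triple_add_middle]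
  abel

end JordanIdentities

/-! ### Power associativity -/

section PowerAssociativity

variable {J : Type*} [NonAssocCommRing J]

/-- Powers in a unital commutative nonassociative ring, `a ^ (n + 1) = a * a ^ n`. -/
def jordanPow (a : J) : ℕ → J
  | 0 => 1
  | n + 1 => a * jordanPow a n

theorem jordanPow_one (a : J) : jordanPow a 1 = a := mul_one a

variable [Module ℝ J]

/-- Evaluation of a real polynomial at an element of a Jordan algebra. -/
noncomputable def polyEval (a : J) : Polynomial ℝ →ₗ[ℝ] J :=
  Polynomial.lsum fun n => LinearMap.toSpanSingleton ℝ J (jordanPow a n)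

theorem polyEval_monomial (a : J) (n : ℕ) (r : ℝ) :
    polyEval a (Polynomial.monomial n r) = r • jordanPow a n := by
  simp [polyEval, Polynomial.sum_monomial_index]

theorem polyEval_one (a : J) : polyEval a 1 = 1 := by
  rw [← Polynomial.monomial_zero_one, polyEval_monomial, one_smul]; rfl

theorem polyEval_C (a : J) (r : ℝ) : polyEval a (Polynomial.C r) = r • 1 := by
  rw [← Polynomial.monomial_zero_left, polyEval_monomial]; rfl

theorem polyEval_X (a : J) : polyEval a Polynomial.X = a := by
  rw [← Polynomial.monomial_one_one_eq_X, polyEval_monomial, one_smul, jordanPow_one]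

variable [IsCommJordan J]

/-- Multiplication by a power of `a` commutes with every operator that commutes with the
multiplications by `a` and `a²`. -/
theorem commute_mulLeft_jordanPow {T : AddMonoid.End J} {a : J}
    (h1 : Commute T (AddMonoid.End.mulLeft a)) (h2 : Commute T (AddMonoid.End.mulLeft (a * a)))
    (n : ℕ) : Commute T (AddMonoid.End.mulLeft (jordanPow a n)) ∧
      Commute T (AddMonoid.End.mulLeft (jordanPow a (n + 1))) := by
  induction n with
  | zero =>
    refine ⟨?_, by rwa [jordanPow_one]⟩
    have : AddMonoid.End.mulLeft (jordanPow a 0) = 1 := by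
      ext x; exact one_mul x
    rw [this]; exact Commute.one_right T
  | succ n ih =>
    refine ⟨ih.2, ?_⟩
    -- the linearized Jordan identity expresses `L_{aⁿ⁺²}` through `L_a`, `L_{a²}`, `L_{aⁿ}`
    -- and `L_{aⁿ⁺¹}`
    have : AddMonoid.End.mulLeft (jordanPow a (n + 1 + 1)) =
        AddMonoid.End.mulLeft (jordanPow a (n + 1)) * AddMonoid.End.mulLeft a
        + AddMonoid.End.mulLeft (jordanPow a (n + 1)) * AddMonoid.End.mulLeft a
        + AddMonoid.End.mulLeft (a * a) * AddMonoid.End.mulLeft (jordanPow a n)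
        - AddMonoid.End.mulLeft (jordanPow a n) *
          (AddMonoid.End.mulLeft a * AddMonoid.End.mulLeft a)
        - AddMonoid.End.mulLeft a *
          (AddMonoid.End.mulLeft a * AddMonoid.End.mulLeft (jordanPow a n)) := by
      ext z
      have h := mul_mul_mul_cyclic z (jordanPow a n) a a
      change (a * (a * jordanPow a n)) * z = (a * jordanPow a n) * (a * z)
        + (a * jordanPow a n) * (a * z) + (a * a) * (jordanPow a n * z)
        - jordanPow a n * (a * (a * z)) - a * (a * (jordanPow a n * z))
      simp only [mul_comm] at h ⊢
      linear_combination (norm := abel) h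
    rw [this]
    exact ((((ih.2.mul_right h1).add_right (ih.2.mul_right h1)).add_right
      (h2.mul_right ih.1)).sub_right (ih.1.mul_right (h1.mul_right h1))).sub_right
      (h1.mul_right (h1.mul_right ih.1))

theorem jordanPow_add (a : J) (m n : ℕ) :
    jordanPow a m * jordanPow a n = jordanPow a (m + n) := by
  have h : Commute (AddMonoid.End.mulLeft a) (AddMonoid.End.mulLeft (jordanPow a n)) :=
    (commute_mulLeft_jordanPow (Commute.refl _) (commute_lmul_lmul_sq a) n).1
  induction m with
  | zero => rw [zero_add]; exact one_mul _
  | succ m ih =>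
    have h' : a * (jordanPow a n * jordanPow a m) = jordanPow a n * (a * jordanPow a m) :=
      DFunLike.congr_fun h.eq (jordanPow a m)
    rw [show jordanPow a (m + 1) = a * jordanPow a m from rfl, mul_comm, ← h',
      mul_comm _ (jordanPow a m), ih, show m + 1 + n = m + n + 1 by ring]
    rfl

theorem polyEval_mul [IsScalarTower ℝ J J] [SMulCommClass ℝ J J] (a : J) (p q : Polynomial ℝ) :
    polyEval a (p * q) = polyEval a p * polyEval a q := by
  induction p using Polynomial.induction_on' with
  | add p p' hp hp' => rw [add_mul, map_add, hp, hp', map_add, add_mul]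
  | monomial m r =>
    induction q using Polynomial.induction_on' with
    | add q q' hq hq' => rw [mul_add, map_add, hq, hq', map_add, mul_add]
    | monomial n s =>
      rw [Polynomial.monomial_mul_monomial, polyEval_monomial, polyEval_monomial,
        polyEval_monomial, smul_mul_smul_comm, jordanPow_add]

end PowerAssociativity

/-! ### Quadratic maps and Jordan inverses -/

section Inverse

variable {A : Type*} [NormedNonAssocCommRing A] [NormedSpace ℝ A]

theorem U_eq_triple (a b : A) : U a b = triple a b a := by
  rw [U, triple, mul_comm a b, mul_comm a (b * a), mul_comm b (a * a)]
  module

theorem U_one_right (a : A) : U a 1 = a * a := by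
  rw [U, mul_one, mul_one]; module

theorem U_one_left (a : A) : U 1 a = a := by
  rw [U, one_mul, mul_one, one_mul, one_mul]; module

theorem IsInverse.U_apply {a b : A} (h : IsInverse a b) : U a b = a := by
  rw [U, h.1, h.2, one_mul]; module

variable [UnitalJBAlgebra A]

theorem U_U (x y z : A) : U (U x y) z = U x (U y (U x z)) := by
  simp only [U_eq_triple, triple_fundamental]

/-- Multiplication as a bounded bilinear map. -/
noncomputable def mulCLM : A →L[ℝ] A →L[ℝ] A :=
  LinearMap.mkContinuous₂ (LinearMap.mul ℝ A) 1 fun a b => by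
    rw [one_mul]; exact UnitalJBAlgebra.norm_mul_le a b

/-- The quadratic map `U_a` as a bounded operator. -/
noncomputable def UCLM (a : A) : A →L[ℝ] A :=
  (2 : ℝ) • (mulCLM a * mulCLM a) - mulCLM (a * a)

theorem UCLM_apply (a b : A) : UCLM a b = U a b := by
  change (2 : ℝ) • (a * (a * b)) - (a * a) * b = _
  rw [U, mul_comm (a * b) a]

theorem continuous_mul_self : Continuous fun a : A => a * a :=
  (mulCLM.continuous.clm_apply continuous_id : Continuous fun a : A => mulCLM a a)

theorem continuous_UCLM : Continuous (UCLM : A → A →L[ℝ] A) :=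
  ((mulCLM.continuous.mul mulCLM.continuous).const_smul (2 : ℝ)).sub
    (mulCLM.continuous.comp continuous_mul_self)

theorem mul_U_comm (a b : A) : a * U a b = U a (a * b) := by
  have h : a * ((a * a) * b) = (a * a) * (a * b) :=
    (IsJordan.lmul_lmul_comm_lmul a b).symm
  rw [U, U, mul_sub, mul_smul_comm, h, mul_comm (a * b) a, mul_comm (a * (a * b)) a]

theorem sq_mul_U_comm (a b : A) : (a * a) * U a b = U a ((a * a) * b) := by
  have h (c : A) : a * ((a * a) * c) = (a * a) * (a * c) :=
    (IsJordan.lmul_lmul_comm_lmul a c).symm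
  rw [U, U, mul_sub, mul_smul_comm, mul_comm (a * b) a, mul_comm (a * (a * a * b)) a, h, h]

variable {a b : A}

theorem IsInverse.U_sq (h : IsInverse a b) : U a (b * b) = 1 := by
  have h1 := mul_mul_mul_cyclic a a b b
  have h2 := mul_mul_mul_cyclic b b a a
  rw [mul_comm b a, h.1] at h1 h2
  simp only [one_mul, h.1] at h1 h2
  rw [mul_comm b ((a * a) * b), mul_comm (a * a * b) b, h.2, mul_comm b a, h.1] at h1
  rw [U, mul_comm (a * (b * b)) a]
  have h3 : (a * a) * (b * b) = 1 := by linear_combination (norm := module) -h1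
  have h4 : a * (a * (b * b)) = 1 := by
    rw [mul_comm b a, h.1, mul_comm (b * b) a,
      mul_comm (b * b) (a * a), h3] at h2
    linear_combination (norm := module) h2
  rw [h3, h4]; module

/-- The bounded operators `U_a` and `U_{a⁻¹}` are inverse to each other, by the fundamental formula
for `U_a b = a` and for `U_a b² = 1`. -/
theorem IsInverse.UCLM_mul (h : IsInverse a b) : UCLM a * UCLM b = 1 ∧ UCLM b * UCLM a = 1 := by
  have e1 : UCLM a * (UCLM b * UCLM a) = UCLM a := by
    ext z
    simp only [mul_apply_eq_comp, UCLM_apply]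
    rw [← U_U, h.U_apply]
  have e2 : UCLM a * (UCLM (b * b) * UCLM a) = 1 := by
    ext z
    simp only [mul_apply_eq_comp, UCLM_apply, one_apply_eq_self]
    rw [← U_U, h.U_sq, U_one_left]
  have hu : IsUnit (UCLM a) := by
    have hl : (UCLM a * UCLM (b * b)) * UCLM a = 1 := by rw [mul_assoc, e2]
    exact isUnit_iff_exists_and_exists.mpr ⟨⟨_, e2⟩, ⟨_, hl⟩⟩
  have e3 : UCLM b * UCLM a = 1 := hu.mul_left_cancel (by rw [e1, mul_one])
  refine ⟨hu.mul_right_cancel ?_, e3⟩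
  rw [mul_assoc, e3, one_mul, mul_one]

theorem IsInverse.U_U (h : IsInverse a b) (z : A) : U a (U b z) = z := by
  have := DFunLike.congr_fun h.UCLM_mul.1 z
  simpa only [mul_apply_eq_comp, UCLM_apply, one_apply_eq_self] using this

theorem IsInverse.U_U' (h : IsInverse a b) (z : A) : U b (U a z) = z := by
  have := DFunLike.congr_fun h.UCLM_mul.2 z
  simpa only [mul_apply_eq_comp, UCLM_apply, one_apply_eq_self] using this

theorem IsInverse.unique {b' : A} (h : IsInverse a b) (h' : IsInverse a b') : b = b' := by
  rw [← h.U_U' b, h.U_apply, ← h'.U_apply, h.U_U']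

/-- If `U_a` has a left inverse and `U_a b = a`, then `b` is the Jordan inverse of `a`, because
`U_a` commutes with the multiplications by `a` and by `a²`. -/
theorem isInverse_of_U {T : A →L[ℝ] A} (h1 : ∀ z, T (U a z) = z) (h2 : U a b = a) :
    IsInverse a b := by
  have hinj {x y : A} (h : U a x = U a y) : x = y := by rw [← h1 x, h, h1]
  constructor
  · exact hinj (by rw [← mul_U_comm, h2, U_one_right])
  · apply hinj
    rw [← sq_mul_U_comm, h2, U, mul_comm ((a * a)) a]
    module

theorem isInvertible_iff_isUnit_UCLM : IsInvertible a ↔ IsUnit (UCLM a) := by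
  constructor
  · rintro ⟨b, h⟩
    exact ⟨⟨UCLM a, UCLM b, h.UCLM_mul.1, h.UCLM_mul.2⟩, rfl⟩
  · rintro ⟨u, hu⟩
    refine ⟨(↑u⁻¹ : A →L[ℝ] A) a, isInverse_of_U (T := (↑u⁻¹ : A →L[ℝ] A)) ?_ ?_⟩
    · intro z
      rw [← UCLM_apply, ← hu, ← mul_apply_eq_comp, Units.inv_mul]; rfl
    · rw [← UCLM_apply, ← hu, ← mul_apply_eq_comp, Units.mul_inv]; rfl

theorem isOpen_isInvertible : IsOpen {a : A | IsInvertible a} := by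
  simp only [isInvertible_iff_isUnit_UCLM]
  exact Units.isOpen.preimage continuous_UCLM

theorem IsInverse.U {x x' y y' : A} (hx : IsInverse x x') (hy : IsInverse y y') :
    IsInverse (U x y) (U x' y') := by
  refine isInverse_of_U (T := UCLM x' * UCLM y' * UCLM x') ?_ ?_
  · intro z
    simp only [mul_apply_eq_comp, UCLM_apply]
    rw [JB.U_U, hx.U_U', hy.U_U', hx.U_U']
  · rw [JB.U_U, hx.U_U, hy.U_apply]

theorem IsInverse.inverse_eq (h : IsInverse a b) : inverse a = b := by
  have h' : IsInvertible a := ⟨b, h⟩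
  rw [inverse, dif_pos h']
  exact h'.choose_spec.unique h

end Inverse

/-! ### The open cone of strictly positive elements -/

section StrictPos

variable {E : Type*} [NormedAddCommGroup E] [NormedSpace ℝ E] [One E]

/-- The open cone `⋃ K, ball (K • 1) K`. In a JB-algebra it is the set of positive invertible
elements. -/
def StrictPos (z : E) : Prop := ∃ K : ℝ, ‖K • (1 : E) - z‖ < K

theorem StrictPos.add {z w : E} (hz : StrictPos z) (hw : StrictPos w) : StrictPos (z + w) := by
  obtain ⟨K, hK⟩ := hz
  obtain ⟨K', hK'⟩ := hw
  refine ⟨K + K', ?_⟩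
  calc ‖(K + K') • (1 : E) - (z + w)‖ = ‖(K • (1 : E) - z) + (K' • (1 : E) - w)‖ := by
        congr 1; module
    _ ≤ _ := norm_add_le _ _
    _ < _ := add_lt_add hK hK'

theorem StrictPos.smul {z : E} (hz : StrictPos z) {r : ℝ} (hr : 0 < r) : StrictPos (r • z) := by
  obtain ⟨K, hK⟩ := hz
  refine ⟨r * K, ?_⟩
  calc ‖(r * K) • (1 : E) - r • z‖ = ‖r • (K • (1 : E) - z)‖ := by congr 1; module
    _ = r * ‖K • (1 : E) - z‖ := by rw [norm_smul, Real.norm_of_nonneg hr.le]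
    _ < r * K := by gcongr

theorem strictPos_smul_one {r : ℝ} (hr : 0 < r) : StrictPos (r • (1 : E)) :=
  ⟨r, by rwa [sub_self, norm_zero]⟩

theorem strictPos_smul_one_sub {r : ℝ} {x : E} (hr : ‖x‖ < r) : StrictPos (r • (1 : E) - x) :=
  ⟨r, by rwa [sub_sub_cancel]⟩

theorem isOpen_strictPos : IsOpen {z : E | StrictPos z} := by
  simp only [StrictPos, Set.ofPred_exists]
  exact isOpen_iUnion fun K =>
    isOpen_lt ((continuous_const.sub continuous_id).norm) continuous_const

theorem StrictPos.exists_forall_sub {z : E} (hz : StrictPos z) :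
    ∃ ε > (0 : ℝ), ∀ δ : ℝ, |δ| < ε → StrictPos (z - δ • (1 : E)) := by
  have hc : Continuous fun δ : ℝ => z - δ • (1 : E) := by fun_prop
  have := (isOpen_strictPos.preimage hc).mem_nhds (show StrictPos (z - (0 : ℝ) • (1 : E)) by
    simpa using hz)
  obtain ⟨ε, hε, h⟩ := Metric.mem_nhds_iff.mp this
  refine ⟨ε, hε, fun δ hδ => h ?_⟩
  rwa [Metric.mem_ball, dist_zero_right]

end StrictPos

/-- The two JB norm conditions on a commutative Banach algebra. They make it an algebra of real
continuous functions. -/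
structure IsJBNorm (C : Type*) [NormedCommRing C] : Prop where
  norm_sq : ∀ x : C, ‖x * x‖ = ‖x‖ ^ 2
  norm_sq_le : ∀ x y : C, ‖x * x‖ ≤ ‖x * x + y * y‖

/-! ### Commutative Banach algebras with a JB-norm -/

section BanachAlgebra

variable {C : Type*} [NormedCommRing C]

theorem IsJBNorm.norm_one_le (hC : IsJBNorm C) : ‖(1 : C)‖ ≤ 1 := by
  have h := hC.norm_sq 1
  rw [mul_one] at h
  nlinarith [norm_nonneg (1 : C)]

/-- Multiplication by `y` is bounded below. -/
def BoundedBelow (y : C) : Prop := ∃ K : ℝ, ∀ z : C, ‖z‖ ≤ K * ‖y * z‖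

theorem boundedBelow_of_isUnit {y : C} (hy : IsUnit y) : BoundedBelow y := by
  obtain ⟨v, hv⟩ := hy.exists_left_inv
  refine ⟨‖v‖, fun z => ?_⟩
  calc ‖z‖ = ‖v * (y * z)‖ := by rw [← mul_assoc, hv, one_mul]
    _ ≤ _ := norm_mul_le _ _

theorem BoundedBelow.mul {x y : C} (hx : BoundedBelow x) (hy : BoundedBelow y) :
    BoundedBelow (x * y) := by
  obtain ⟨K, hK⟩ := hx
  obtain ⟨L, hL⟩ := hy
  refine ⟨|L| * K, fun z => ?_⟩
  calc ‖z‖ ≤ L * ‖y * z‖ := hL z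
    _ ≤ |L| * ‖y * z‖ := by gcongr; exact le_abs_self L
    _ ≤ |L| * (K * ‖x * (y * z)‖) := by gcongr; exact hK _
    _ = _ := by rw [mul_assoc, mul_assoc]

theorem BoundedBelow.of_mul {x y : C} (h : BoundedBelow (x * y)) : BoundedBelow y := by
  obtain ⟨K, hK⟩ := h
  refine ⟨|K| * ‖x‖, fun z => ?_⟩
  calc ‖z‖ ≤ K * ‖x * y * z‖ := hK z
    _ ≤ |K| * ‖x * (y * z)‖ := by rw [mul_assoc]; gcongr; exact le_abs_self K
    _ ≤ |K| * (‖x‖ * ‖y * z‖) := by gcongr; exact norm_mul_le _ _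
    _ = _ := by ring

variable [NormedAlgebra ℝ C] [CompleteSpace C]

/-- If `‖x‖ < 1` then `1 - x` is the square of `1 - y`, where `y` is the fixed point of the
contraction `y ↦ (x + y²) / 2`. -/
theorem exists_mul_self_eq_one_sub {x : C} (hx : ‖x‖ < 1) : ∃ y : C, y * y = 1 - x := by
  set T : C → C := fun y => (1 / 2 : ℝ) • (x + y * y) with hT
  set r := ‖x‖
  have hr0 : 0 ≤ r := norm_nonneg x
  have hmaps : Set.MapsTo T (Metric.closedBall 0 r) (Metric.closedBall 0 r) := by
    intro y hy
    rw [mem_closedBall_zero_iff] at hy ⊢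
    have h1 : ‖y * y‖ ≤ r * r :=
      (norm_mul_le _ _).trans (mul_le_mul hy hy (norm_nonneg _) hr0)
    have h2 : ‖x + y * y‖ ≤ r + r * r := (norm_add_le _ _).trans (by gcongr)
    rw [hT, norm_smul, Real.norm_of_nonneg (by norm_num)]
    nlinarith
  have hcontr : ContractingWith (Real.toNNReal r) (hmaps.restrict T _ _) := by
    refine ⟨by rwa [Real.toNNReal_lt_one], LipschitzWith.of_dist_le_mul ?_⟩
    rintro ⟨y, hy⟩ ⟨z, hz⟩
    rw [mem_closedBall_zero_iff] at hy hz
    rw [Subtype.dist_eq, Subtype.dist_eq, Real.coe_toNNReal _ hr0]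
    change dist (T y) (T z) ≤ r * dist y z
    rw [dist_eq_norm, dist_eq_norm, hT]
    have : (1 / 2 : ℝ) • (x + y * y) - (1 / 2 : ℝ) • (x + z * z) =
        (1 / 2 : ℝ) • ((y + z) * (y - z)) := by
      rw [← smul_sub]; congr 1; ring
    rw [this, norm_smul, Real.norm_of_nonneg (by norm_num)]
    have h2 : ‖y + z‖ ≤ r + r := (norm_add_le _ _).trans (add_le_add hy hz)
    have h3 : ‖(y + z) * (y - z)‖ ≤ (r + r) * ‖y - z‖ :=
      (norm_mul_le _ _).trans (by gcongr)
    linarith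
  obtain ⟨y, -, hy, -⟩ := hcontr.exists_fixedPoint' (Metric.isClosed_closedBall.isComplete) hmaps
    (x := 0) (by simpa using hr0) (edist_ne_top _ _)
  refine ⟨1 - y, ?_⟩
  have hy' : (1 / 2 : ℝ) • (x + y * y) = y := hy
  have h2 : x + y * y = (2 : ℝ) • y := by
    conv_rhs => rw [← hy', smul_smul]
    norm_num
  rw [two_smul] at h2
  linear_combination h2

theorem StrictPos.exists_mul_self_eq {z : C} (hz : StrictPos z) : ∃ y : C, y * y = z := by
  obtain ⟨K, hK⟩ := hz
  have hK0 : 0 < K := (norm_nonneg _).trans_lt hK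
  have h1 : ‖K⁻¹ • (K • (1 : C) - z)‖ < 1 := by
    rw [norm_smul, norm_inv, Real.norm_of_nonneg hK0.le, inv_mul_lt_one₀ hK0]; exact hK
  obtain ⟨y, hy⟩ := exists_mul_self_eq_one_sub h1
  refine ⟨Real.sqrt K • y, ?_⟩
  rw [smul_mul_smul_comm, Real.mul_self_sqrt hK0.le, hy, smul_sub, smul_smul, smul_sub,
    smul_smul, mul_inv_cancel₀ hK0.ne', one_mul, one_smul, sub_sub_cancel]

theorem StrictPos.isUnit {z : C} (hz : StrictPos z) : IsUnit z := by
  obtain ⟨K, hK⟩ := hz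
  have hK0 : 0 < K := (norm_nonneg _).trans_lt hK
  have h1 : ‖K⁻¹ • (K • (1 : C) - z)‖ < 1 := by
    rw [norm_smul, norm_inv, Real.norm_of_nonneg hK0.le, inv_mul_lt_one₀ hK0]; exact hK
  have h2 := isUnit_one_sub_of_norm_lt_one h1
  rw [smul_sub, smul_smul, inv_mul_cancel₀ hK0.ne', one_smul, sub_sub_cancel] at h2
  exact (isUnit_smul_iff (Units.mk0 K⁻¹ (inv_ne_zero hK0.ne')) z).mp h2

theorem IsJBNorm.strictPos_mul_self_add (hC : IsJBNorm C) (x : C) {δ : ℝ} (hδ : 0 < δ) :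
    StrictPos (x * x + δ • (1 : C)) := by
  set k := ‖x‖ + 1
  have hk : 0 < k := by positivity
  have hx : ‖k⁻¹ • x‖ < 1 := by
    rw [norm_smul, norm_inv, Real.norm_of_nonneg hk.le, inv_mul_lt_one₀ hk]
    exact lt_add_one _
  have hxx : ‖(k⁻¹ • x) * (k⁻¹ • x)‖ < 1 := by
    rw [hC.norm_sq]; nlinarith [norm_nonneg (k⁻¹ • x)]
  obtain ⟨y, hy⟩ := exists_mul_self_eq_one_sub hxx
  have h1 : ‖1 - (k⁻¹ • x) * (k⁻¹ • x)‖ ≤ 1 := by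
    rw [← hy]
    refine (hC.norm_sq_le y (k⁻¹ • x)).trans ?_
    rw [hy, sub_add_cancel]; exact hC.norm_one_le
  refine ⟨k * k + δ, ?_⟩
  have h2 : (k * k + δ) • (1 : C) - (x * x + δ • (1 : C)) =
      (k * k) • (1 - (k⁻¹ • x) * (k⁻¹ • x)) := by
    rw [smul_mul_smul_comm, smul_sub, smul_smul,
      show k * k * (k⁻¹ * k⁻¹) = 1 by field_simp]
    module
  rw [h2, norm_smul, Real.norm_of_nonneg (by positivity)]
  nlinarith [mul_pos hk hk]

theorem IsJBNorm.norm_le_one (hC : IsJBNorm C) {x : C} (h1 : StrictPos (1 - x))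
    (h2 : StrictPos (1 + x)) : ‖x‖ ≤ 1 := by
  obtain ⟨u, hu⟩ := h1.exists_mul_self_eq
  obtain ⟨v, hv⟩ := h2.exists_mul_self_eq
  have h : x * x + (u * v) * (u * v) = 1 := by
    linear_combination (v * v) * hu + (1 - x) * hv
  have h3 := hC.norm_sq_le x (u * v)
  rw [h, hC.norm_sq] at h3
  have h4 := hC.norm_one_le
  nlinarith [norm_nonneg x]

/-- The square of a unit is strictly positive, since its inverse is bounded and positive. -/
theorem IsJBNorm.strictPos_mul_self (hC : IsJBNorm C) {s : C} (hs : IsUnit s) :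
    StrictPos (s * s) := by
  obtain ⟨v, hv⟩ := hs.exists_right_inv
  set K := ‖v * v‖ + 1
  have hK : 0 < K := by positivity
  obtain ⟨t, ht⟩ := (strictPos_smul_one_sub (lt_add_one ‖v * v‖)).exists_mul_self_eq
  have h1 : (t * s) * (t * s) + (1 : ℝ) • (1 : C) = K • (s * s) := by
    rw [one_smul, show (t * s) * (t * s) = (t * t) * (s * s) by ring, ht, sub_mul,
      smul_mul_assoc, one_mul, show v * v * (s * s) = (s * v) * (s * v) by ring, hv]
    simp [K]
  have h2 := (hC.strictPos_mul_self_add (t * s) one_pos).smul (inv_pos.mpr hK)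
  rwa [h1, smul_smul, inv_mul_cancel₀ hK.ne', one_smul] at h2

/-- A positive element that is bounded below is strictly positive: the inverses of `y + δ` stay
bounded as `δ` tends to `0`, so `y` is an invertible square. -/
theorem IsJBNorm.strictPos_of_boundedBelow (hC : IsJBNorm C) {y : C}
    (hy : ∀ δ > (0 : ℝ), StrictPos (y + δ • (1 : C))) (hb : BoundedBelow y) : StrictPos y := by
  obtain ⟨K₀, hK₀⟩ := hb
  set K := |K₀| + 1
  have hK0 : 0 < K := by positivity
  have hK (z : C) : ‖z‖ ≤ K * ‖y * z‖ := (hK₀ z).trans (by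
    gcongr; exact (le_abs_self K₀).trans (le_add_of_nonneg_right zero_le_one))
  -- with this `δ` the bound `‖v‖ ≤ K * (1 + δ * ‖v‖)` gives `‖δ • v‖ < 1`
  set δ := 1 / (4 * K)
  have hδ : 0 < δ := by positivity
  have hp := hy δ hδ
  obtain ⟨v, hv⟩ := hp.isUnit.exists_right_inv
  have hyv : y * v = 1 - δ • v := by
    rw [add_mul, smul_mul_assoc, one_mul] at hv
    exact eq_sub_of_add_eq hv
  have hn : ‖δ • v‖ < 1 := by
    have h1 : ‖v‖ ≤ K * (1 + δ * ‖v‖) := by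
      refine (hK v).trans ?_
      rw [hyv]
      gcongr
      refine (norm_sub_le _ _).trans ?_
      rw [norm_smul, Real.norm_of_nonneg hδ.le]
      gcongr
      exact hC.norm_one_le
    rw [norm_smul, Real.norm_of_nonneg hδ.le]
    have h2 : K * δ = 1 / 4 := by simp only [δ]; field_simp
    nlinarith [norm_nonneg v]
  have hq : StrictPos (1 - δ • v) := by
    have := strictPos_smul_one_sub hn
    rwa [one_smul] at this
  obtain ⟨s, hs⟩ := hp.exists_mul_self_eq
  obtain ⟨t, ht⟩ := hq.exists_mul_self_eq
  have hst : (s * t) * (s * t) = y := by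
    rw [show (s * t) * (s * t) = (s * s) * (t * t) by ring, hs, ht, ← hyv, mul_left_comm, hv,
      mul_one]
  have hu : IsUnit ((s * t) * (s * t)) := by
    rw [show (s * t) * (s * t) = (s * s) * (t * t) by ring, hs, ht]
    exact hp.isUnit.mul hq.isUnit
  rw [← hst]
  exact hC.strictPos_mul_self (isUnit_of_mul_isUnit_left hu)

/-- If `r - x` is bounded below for all `r > M`, then `r - x` is strictly positive for
all `r > M`: the infimum of the `r` with this property cannot exceed `M`. -/
theorem IsJBNorm.strictPos_smul_one_sub_of_forall (hC : IsJBNorm C) {x : C} {M : ℝ}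
    (h : ∀ r, M < r → BoundedBelow (r • (1 : C) - x)) {r : ℝ} (hr : M < r) :
    StrictPos (r • (1 : C) - x) := by
  set S : Set ℝ := {c | r ≤ c ∧ StrictPos (c • (1 : C) - x)}
  have hne : S.Nonempty := ⟨max r (‖x‖ + 1), le_max_left _ _,
    strictPos_smul_one_sub ((lt_add_one _).trans_le (le_max_right _ _))⟩
  have hbdd : BddBelow S := ⟨r, fun c hc => hc.1⟩
  set m := sInf S
  have hrm : r ≤ m := le_csInf hne fun c hc => hc.1
  have hm : StrictPos (m • (1 : C) - x) := by
    refine hC.strictPos_of_boundedBelow (fun δ hδ => ?_) (h m (hr.trans_le hrm))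
    obtain ⟨c, hc, hcm⟩ := exists_lt_of_csInf_lt hne (lt_add_of_pos_right m hδ)
    have := hc.2.add (strictPos_smul_one (E := C) (sub_pos.mpr hcm))
    convert this using 1
    module
  rcases hrm.eq_or_lt with hrm | hrm
  · rwa [hrm]
  obtain ⟨ε, hε, hsub⟩ := hm.exists_forall_sub
  have hδ : 0 < min (ε / 2) (m - r) := lt_min (by positivity) (sub_pos.mpr hrm)
  have h1 := hsub (min (ε / 2) (m - r)) (by
    rw [abs_of_pos hδ]; exact (min_le_left _ _).trans_lt (half_lt_self hε))
  have h2 : m - min (ε / 2) (m - r) ∈ S := by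
    refine ⟨by linarith [min_le_right (ε / 2) (m - r)], ?_⟩
    convert h1 using 1
    module
  linarith [csInf_le hbdd h2]

/-- The norm is bounded by the spectral radius: both `r - x` and `r + x` are strictly positive for
`r > M`. -/
theorem IsJBNorm.norm_le_of_forall (hC : IsJBNorm C) {x : C} {M : ℝ} (hM : 0 ≤ M)
    (h : ∀ r, M < |r| → BoundedBelow (r • (1 : C) - x)) : ‖x‖ ≤ M := by
  refine le_of_forall_gt_imp_ge_of_dense fun r hr => ?_
  have hr0 : 0 < r := hM.trans_lt hr
  have h1 : StrictPos (r • (1 : C) - x) :=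
    hC.strictPos_smul_one_sub_of_forall (fun r hr => h r (hr.trans_le (le_abs_self r))) hr
  have h2 : StrictPos (r • (1 : C) - -x) := by
    refine hC.strictPos_smul_one_sub_of_forall (fun r hr => ?_) hr
    obtain ⟨K, hK⟩ := h (-r) (by rw [abs_neg]; exact hr.trans_le (le_abs_self r))
    refine ⟨K, fun z => (hK z).trans_eq ?_⟩
    rw [← norm_neg ((r • (1 : C) - -x) * z), ← neg_mul]
    congr 3
    module
  have h3 : ‖r⁻¹ • x‖ ≤ 1 := by
    refine hC.norm_le_one ?_ ?_
    · convert h1.smul (inv_pos.mpr hr0) using 1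
      rw [smul_sub, smul_smul, inv_mul_cancel₀ hr0.ne', one_smul]
    · convert h2.smul (inv_pos.mpr hr0) using 1
      rw [smul_sub, smul_smul, inv_mul_cancel₀ hr0.ne', one_smul, smul_neg, sub_neg_eq_add]
  rwa [norm_smul, norm_inv, Real.norm_of_nonneg hr0.le, inv_mul_le_one₀ hr0] at h3

end BanachAlgebra

/-! ### The norm of polynomials in one element -/

section GeneratedSubalgebra

variable {A : Type*} [NormedNonAssocCommRing A] [NormedSpace ℝ A]

/-- The closed subalgebra generated by `a` and the unit. It is associative. -/
noncomputable def generated (a : A) : Submodule ℝ A :=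
  (LinearMap.range (polyEval a)).topologicalClosure

theorem polyEval_mem_generated (a : A) (p : Polynomial ℝ) : polyEval a p ∈ generated a :=
  Submodule.le_topologicalClosure _ (LinearMap.mem_range_self _ p)

theorem exists_tendsto_polyEval {a x : A} (hx : x ∈ generated a) :
    ∃ p : ℕ → Polynomial ℝ, Filter.Tendsto (fun n => polyEval a (p n)) Filter.atTop (nhds x) := by
  have hx' : x ∈ closure (Set.range (polyEval a)) := by
    rw [← LinearMap.coe_range, ← Submodule.topologicalClosure_coe]; exact hx
  obtain ⟨u, hu, hlim⟩ := mem_closure_iff_seq_limit.mp hx'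
  choose p hp using hu
  exact ⟨p, by simpa only [hp] using hlim⟩

/-- Evaluation of polynomials at `a`, with values in the subalgebra generated by `a`. -/
noncomputable def polyEvalGen (a : A) (p : Polynomial ℝ) : generated a :=
  ⟨polyEval a p, polyEval_mem_generated a p⟩

theorem polyEvalGen_add (a : A) (p q : Polynomial ℝ) :
    polyEvalGen a (p + q) = polyEvalGen a p + polyEvalGen a q :=
  Subtype.ext (map_add (polyEval a) p q)

theorem polyEvalGen_sub (a : A) (p q : Polynomial ℝ) :
    polyEvalGen a (p - q) = polyEvalGen a p - polyEvalGen a q :=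
  Subtype.ext (map_sub (polyEval a) p q)

variable [UnitalJBAlgebra A]

instance instContinuousMul : ContinuousMul A :=
  ⟨(mulCLM.continuous.comp continuous_fst).clm_apply continuous_snd⟩

theorem mul_mem_generated {a x y : A} (hx : x ∈ generated a) (hy : y ∈ generated a) :
    x * y ∈ generated a := by
  obtain ⟨p, hp⟩ := exists_tendsto_polyEval hx
  obtain ⟨q, hq⟩ := exists_tendsto_polyEval hy
  refine (Submodule.isClosed_topologicalClosure _).mem_of_tendsto (hp.mul hq)
    (Filter.Eventually.of_forall fun n => ?_)
  rw [← polyEval_mul]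
  exact polyEval_mem_generated a _

theorem mul_assoc_of_mem_generated {a x y z : A} (hx : x ∈ generated a) (hy : y ∈ generated a)
    (hz : z ∈ generated a) : x * y * z = x * (y * z) := by
  obtain ⟨p, hp⟩ := exists_tendsto_polyEval hx
  obtain ⟨q, hq⟩ := exists_tendsto_polyEval hy
  obtain ⟨r, hr⟩ := exists_tendsto_polyEval hz
  refine tendsto_nhds_unique ((hp.mul hq).mul hr) ?_
  simp only [← polyEval_mul, mul_assoc]
  simp only [polyEval_mul]
  exact hp.mul (hq.mul hr)

noncomputable instance instNormedCommRingGenerated (a : A) : NormedCommRing (generated a) :=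
  { (inferInstance : NormedAddCommGroup (generated a)) with
    mul := fun x y => ⟨x.1 * y.1, mul_mem_generated x.2 y.2⟩
    one := ⟨1, by rw [← polyEval_one a]; exact polyEval_mem_generated a 1⟩
    mul_assoc := fun x y z => Subtype.ext (mul_assoc_of_mem_generated x.2 y.2 z.2)
    mul_comm := fun x y => Subtype.ext (mul_comm x.1 y.1)
    one_mul := fun x => Subtype.ext (one_mul x.1)
    mul_one := fun x => Subtype.ext (mul_one x.1)
    zero_mul := fun x => Subtype.ext (zero_mul x.1)
    mul_zero := fun x => Subtype.ext (mul_zero x.1)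
    left_distrib := fun x y z => Subtype.ext (mul_add x.1 y.1 z.1)
    right_distrib := fun x y z => Subtype.ext (add_mul x.1 y.1 z.1)
    norm_mul_le := fun x y => UnitalJBAlgebra.norm_mul_le x.1 y.1 }

theorem generated_coe_mul {a : A} (x y : generated a) : ((x * y : generated a) : A) = x * y := rfl

noncomputable instance instNormedAlgebraGenerated (a : A) : NormedAlgebra ℝ (generated a) :=
  { Algebra.ofModule (R := ℝ) (A := generated a)
      (fun r x y => Subtype.ext (smul_mul_assoc r x.1 y.1))
      (fun r x y => Subtype.ext (mul_smul_comm r x.1 y.1)) with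
    norm_smul_le := fun r x => norm_smul_le r x.1 }

instance instCompleteSpaceGenerated (a : A) : CompleteSpace (generated a) :=
  (Submodule.isClosed_topologicalClosure _).completeSpace_coe

theorem isJBNorm_generated (a : A) : IsJBNorm (generated a) where
  norm_sq x := UnitalJBAlgebra.norm_sq x.1
  norm_sq_le x y := UnitalJBAlgebra.norm_sq_le x.1 y.1

theorem polyEvalGen_mul (a : A) (p q : Polynomial ℝ) :
    polyEvalGen a (p * q) = polyEvalGen a p * polyEvalGen a q :=
  Subtype.ext (polyEval_mul a p q)

theorem polyEvalGen_C (a : A) (r : ℝ) : polyEvalGen a (Polynomial.C r) = r • 1 :=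
  Subtype.ext (polyEval_C a r)

/-- An element of an associative subalgebra that is invertible in the Jordan algebra is bounded
below, because `U_b U_x = 1` for its Jordan inverse `b`. -/
theorem boundedBelow_of_isInvertible {a : A} (x : generated a) (hx : IsInvertible (x : A)) :
    BoundedBelow x := by
  obtain ⟨b, hb⟩ := hx
  refine BoundedBelow.of_mul (x := x) ⟨‖UCLM b‖, fun z => ?_⟩
  have h1 : U (x : A) z = ((x * x * z : generated a) : A) := by
    have h2 : x * z * x = x * x * z := by ring
    rw [U, ← generated_coe_mul, ← generated_coe_mul, ← generated_coe_mul, ← generated_coe_mul, h2]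
    module
  calc ‖z‖ = ‖UCLM b (U (x : A) z)‖ := by rw [UCLM_apply, hb.U_U']; rfl
    _ ≤ _ := ContinuousLinearMap.le_opNorm _ _
    _ = _ := by rw [h1]; rfl

theorem isInvertible_of_isUnit {a : A} {x : generated a} (hx : IsUnit x) :
    IsInvertible (x : A) := by
  obtain ⟨v, hv⟩ := hx.exists_right_inv
  refine ⟨v, congrArg Subtype.val hv, ?_⟩
  have : x * x * v = x := by rw [mul_assoc, hv, mul_one]
  exact congrArg Subtype.val this

theorem boundedBelow_polyEvalGen (a : A) (q : Polynomial ℝ) (hq : q ≠ 0)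
    (h : ∀ t ∈ spec a, q.eval t ≠ 0) : BoundedBelow (polyEvalGen a q) := by
  have hconst (c : ℝ) (hc : c ≠ 0) : BoundedBelow (polyEvalGen a (Polynomial.C c)) := by
    refine boundedBelow_of_isUnit ?_
    rw [polyEvalGen_C, ← Algebra.algebraMap_eq_smul_one]
    exact (IsUnit.mk0 c hc).map (algebraMap ℝ (generated a))
  induction q using WfDvdMonoid.induction_on_irreducible with
  | zero => exact absurd rfl hq
  | unit u hu =>
    obtain ⟨c, hc, rfl⟩ := Polynomial.isUnit_iff.mp hu
    exact hconst c hc.ne_zero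
  | mul q i hq0 hi ih =>
    rw [polyEvalGen_mul]
    have hq' := ih hq0 fun t ht h0 => h t ht (by rw [Polynomial.eval_mul, h0, mul_zero])
    have hi' : ∀ t ∈ spec a, i.eval t ≠ 0 := fun t ht h0 =>
      h t ht (by rw [Polynomial.eval_mul, h0, zero_mul])
    refine BoundedBelow.mul ?_ hq'
    have hdeg := hi.natDegree_le_two
    have hpos := hi.natDegree_pos
    obtain hd | hd : i.natDegree = 1 ∨ i.natDegree = 2 := by omega
    · obtain ⟨c, d, rfl⟩ := Polynomial.exists_eq_X_add_C_of_natDegree_le_one hd.le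
      have hc : c ≠ 0 := by
        rintro rfl
        rw [Polynomial.C_0, zero_mul, zero_add, Polynomial.natDegree_C] at hd
        exact zero_ne_one hd
      have ht : -d / c ∉ spec a := fun ht => hi' _ ht (by simp; field_simp; ring)
      have he : Polynomial.C c * Polynomial.X + Polynomial.C d =
          Polynomial.C c * (Polynomial.X - Polynomial.C (-d / c)) := by
        rw [mul_sub, ← Polynomial.C_mul, mul_div_cancel₀ _ hc, Polynomial.C_neg, sub_neg_eq_add]
      rw [he, polyEvalGen_mul]
      refine (hconst c hc).mul (boundedBelow_of_isInvertible _ ?_)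
      have : ((polyEvalGen a (Polynomial.X - Polynomial.C (-d / c)) : generated a) : A) =
          a - (-d / c) • (1 : A) := by
        change polyEval a _ = _
        rw [map_sub, polyEval_X, polyEval_C]
      rw [this]
      exact not_not.mp ht
    · -- complete the square
      have hroot (t : ℝ) : i.eval t ≠ 0 :=
        hi.not_isRoot_of_natDegree_ne_one (by rw [hd]; norm_num)
      have hlead : i.coeff 2 ≠ 0 := by
        rw [← hd]; exact Polynomial.leadingCoeff_ne_zero.mpr hi.ne_zero
      have hsum : i = Polynomial.C (i.coeff 0) + Polynomial.C (i.coeff 1) * Polynomial.X +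
          Polynomial.C (i.coeff 2) * Polynomial.X ^ 2 := by
        conv_lhs => rw [i.as_sum_range_C_mul_X_pow, hd]
        simp [Finset.sum_range_succ]
      generalize i.coeff 0 = γ at hsum hlead
      generalize i.coeff 1 = β at hsum hlead
      generalize i.coeff 2 = α at hsum hlead
      subst hsum
      have hdisc : discrim α β γ < 0 := by
        by_contra! hneg
        obtain ⟨t, ht⟩ := exists_quadratic_eq_zero hlead
          ⟨Real.sqrt (discrim α β γ), (Real.mul_self_sqrt hneg).symm⟩
        refine hroot t ?_
        rw [← ht]
        simp
        ring
      set κ := -discrim α β γ / (4 * α ^ 2)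
      have hκ : 0 < κ := div_pos (neg_pos.mpr hdisc) (by positivity)
      have he : Polynomial.C γ + Polynomial.C β * Polynomial.X + Polynomial.C α * Polynomial.X ^ 2 =
          Polynomial.C α * ((Polynomial.X + Polynomial.C (β / (2 * α))) *
            (Polynomial.X + Polynomial.C (β / (2 * α))) + Polynomial.C κ) := by
        refine Polynomial.funext fun t => ?_
        simp only [Polynomial.eval_add, Polynomial.eval_mul, Polynomial.eval_C, Polynomial.eval_X,
          Polynomial.eval_pow, κ, discrim]
        field_simp
        ring
      rw [he, polyEvalGen_mul, polyEvalGen_add, polyEvalGen_mul, polyEvalGen_C a κ]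
      exact (hconst α hlead).mul (boundedBelow_of_isUnit
        ((isJBNorm_generated a).strictPos_mul_self_add _ hκ).isUnit)

theorem norm_polyEval_le_of_forall {a : A} {p : Polynomial ℝ} {M : ℝ} (hM : 0 ≤ M)
    (h : ∀ r, M < |r| → Polynomial.C r - p ≠ 0 ∧ ∀ t ∈ spec a, p.eval t ≠ r) :
    ‖polyEval a p‖ ≤ M := by
  refine (isJBNorm_generated a).norm_le_of_forall (x := polyEvalGen a p) hM fun r hr => ?_
  rw [← polyEvalGen_C, ← polyEvalGen_sub]
  refine boundedBelow_polyEvalGen a _ (h r hr).1 fun t ht h0 => (h r hr).2 t ht ?_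
  rw [Polynomial.eval_sub, Polynomial.eval_C, sub_eq_zero] at h0
  exact h0.symm

theorem spec_nonempty [Nontrivial A] (a : A) : (spec a).Nonempty := by
  by_contra! hempty
  have ha : ‖polyEval a Polynomial.X‖ ≤ 0 := by
    refine norm_polyEval_le_of_forall le_rfl fun r _ => ⟨fun h0 => ?_, by simp [hempty]⟩
    have := congrArg (Polynomial.eval (r + 1)) h0
    simp at this
  rw [polyEval_X, norm_le_zero_iff] at ha
  have h0 : (0 : ℝ) ∉ spec a := by simp [hempty]
  obtain ⟨b, hb⟩ := not_not.mp h0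
  have := hb.1
  rw [ha] at this
  simp at this

/-- The von Neumann inequality: the norm of `p(a)` is bounded by the supremum of `|p|` on the
spectrum of `a`. -/
theorem norm_polyEval_le (a : A) (p : Polynomial ℝ) {M : ℝ} (hM : 0 ≤ M)
    (h : ∀ t ∈ spec a, |p.eval t| ≤ M) : ‖polyEval a p‖ ≤ M := by
  rcases subsingleton_or_nontrivial A with _ | _
  · rwa [Subsingleton.elim (polyEval a p) 0, norm_zero]
  refine norm_polyEval_le_of_forall hM fun r hr => ⟨fun h0 => ?_, fun t ht h0 => ?_⟩
  · obtain ⟨t, ht⟩ := spec_nonempty a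
    have := h t ht
    rw [← sub_eq_zero.mp h0, Polynomial.eval_C] at this
    exact this.not_gt hr
  · have := h t ht
    rw [h0] at this
    exact this.not_gt hr

end GeneratedSubalgebra

/-! ### Continuous functional calculus -/

section FunctionalCalculus

variable {A : Type*} [NormedNonAssocCommRing A]

theorem IsInvertible.neg {a : A} (ha : IsInvertible a) : IsInvertible (-a) := by
  obtain ⟨b, hb⟩ := ha
  refine ⟨-b, ?_, ?_⟩
  · rw [neg_mul_neg, hb.1]
  · rw [neg_mul_neg, mul_neg, hb.2]

theorem isInverse_one_one : IsInverse (1 : A) 1 := ⟨mul_one 1, by rw [mul_one, mul_one]⟩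

variable [NormedSpace ℝ A]

theorem IsFunctionalCalculus.isInverse {a : A} {Φ : C(spec a, ℝ) →ₗ[ℝ] A}
    (hΦ : IsFunctionalCalculus a Φ) {f g : C(spec a, ℝ)} (h : f * g = 1) :
    IsInverse (Φ f) (Φ g) := by
  constructor
  · rw [← hΦ.map_mul, h, hΦ.map_one]
  · rw [← hΦ.map_mul, ← hΦ.map_mul, mul_assoc, h, mul_one]

theorem IsFunctionalCalculus.U_apply {a : A} {Φ : C(spec a, ℝ) →ₗ[ℝ] A}
    (hΦ : IsFunctionalCalculus a Φ) (f g : C(spec a, ℝ)) : U (Φ f) (Φ g) = Φ (f * f * g) := by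
  rw [U, ← hΦ.map_mul, ← hΦ.map_mul, ← hΦ.map_mul, ← hΦ.map_mul,
    show f * g * f = f * f * g by ring]
  module

variable [UnitalJBAlgebra A]

theorem StrictPos.isInvertible {a : A} (ha : StrictPos a) : IsInvertible a := by
  have hx : StrictPos (polyEvalGen a Polynomial.X) := by
    obtain ⟨K, hK⟩ := ha
    refine ⟨K, ?_⟩
    change ‖K • (1 : A) - polyEval a Polynomial.X‖ < K
    rwa [polyEval_X]
  have := isInvertible_of_isUnit hx.isUnit
  rwa [show ((polyEvalGen a Polynomial.X : generated a) : A) = a from polyEval_X a] at this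

theorem spec_subset_closedBall (a : A) : spec a ⊆ Metric.closedBall 0 ‖a‖ := by
  intro r hr
  rw [mem_closedBall_zero_iff, Real.norm_eq_abs]
  by_contra! h
  apply hr
  rcases lt_abs.mp h with h | h
  · have := (strictPos_smul_one_sub h).isInvertible.neg
    rwa [neg_sub] at this
  · rw [← norm_neg a] at h
    have := (strictPos_smul_one_sub h).isInvertible
    rwa [show (-r) • (1 : A) - -a = a - r • (1 : A) by module] at this

theorem isClosed_spec (a : A) : IsClosed (spec a) := by
  have hc : Continuous fun r : ℝ => a - r • (1 : A) := by fun_prop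
  exact isOpen_compl_iff.mp (by
    convert isOpen_isInvertible.preimage hc using 1
    ext r
    exact not_not)

instance instCompactSpaceSpec (a : A) : CompactSpace (spec a) :=
  isCompact_iff_compactSpace.mp
    ((isCompact_closedBall 0 ‖a‖).of_isClosed_subset (isClosed_spec a) (spec_subset_closedBall a))

/-- Every element of a unital JB-algebra has a contractive continuous functional calculus. -/
theorem exists_isFunctionalCalculus (a : A) :
    ∃ Φ : C(spec a, ℝ) →L[ℝ] A, IsFunctionalCalculus a Φ.toLinearMap ∧ ∀ f, ‖Φ f‖ ≤ ‖f‖ := by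
  set e : Polynomial ℝ →ₗ[ℝ] C(spec a, ℝ) :=
    (Polynomial.toContinuousMapOnAlgHom (spec a)).toLinearMap
  have hdense : DenseRange e := by
    have h := ContinuousMap.subalgebra_topologicalClosure_eq_top_of_separatesPoints
      (polynomialFunctions (spec a)) (polynomialFunctions_separatesPoints (spec a))
    have h' := congrArg (fun S : Subalgebra ℝ C(spec a, ℝ) => (S : Set C(spec a, ℝ))) h
    simp only [Subalgebra.topologicalClosure_coe, polynomialFunctions_coe] at h'
    exact dense_iff_closure_eq.mpr h'
  have hnorm (p : Polynomial ℝ) : ‖polyEval a p‖ ≤ 1 * ‖e p‖ := by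
    rw [one_mul]
    exact norm_polyEval_le a p (norm_nonneg _) fun t ht => (e p).norm_coe_le_norm ⟨t, ht⟩
  have heq (p : Polynomial ℝ) : (polyEval a).extendOfNorm e (e p) = polyEval a p :=
    LinearMap.extendOfNorm_eq hdense ⟨1, hnorm⟩ p
  refine ⟨(polyEval a).extendOfNorm e, ⟨?_, ?_, ?_, ContinuousLinearMap.continuous _⟩, fun f => ?_⟩
  · have h1 : e 1 = 1 := map_one (Polynomial.toContinuousMapOnAlgHom (spec a))
    have := heq 1
    rwa [h1, polyEval_one] at this
  · intro f g
    refine hdense.induction_on₂ (p := fun f g => (polyEval a).extendOfNorm e (f * g) =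
      (polyEval a).extendOfNorm e f * (polyEval a).extendOfNorm e g) ?_ ?_ f g
    · exact isClosed_eq (by fun_prop) (by fun_prop)
    · intro p q
      have h1 : e (p * q) = e p * e q := map_mul (Polynomial.toContinuousMapOnAlgHom (spec a)) p q
      rw [← h1, heq, heq, heq, polyEval_mul]
  · have := heq Polynomial.X
    rw [polyEval_X] at this
    have h1 : e Polynomial.X = ⟨fun x => (x : ℝ), continuous_subtype_val⟩ := by
      ext t
      simp [e]
    rwa [h1] at this
  · simpa only [one_mul] using LinearMap.norm_extendOfNorm_apply_le hdense 1 hnorm f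

/-- `f(a)` is given by one and the same functional calculus for all functions `f` that are
continuous on the spectrum. -/
theorem exists_fc_eq (a : A) : ∃ Φ : C(spec a, ℝ) →ₗ[ℝ] A, IsFunctionalCalculus a Φ ∧
    ∀ (f : ℝ → ℝ) (hf : ContinuousOn f (spec a)),
      fc f a = Φ ⟨(spec a).domRestrict f, continuousOn_iff_continuous_domRestrict.mp hf⟩ := by
  obtain ⟨Ψ, hΨ, -⟩ := exists_isFunctionalCalculus a
  have h : ∃ Φ : C(spec a, ℝ) →ₗ[ℝ] A, IsFunctionalCalculus a Φ := ⟨_, hΨ⟩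
  exact ⟨h.choose, h.choose_spec, fun f hf => by rw [fc, dif_pos ⟨h, hf⟩]⟩

end FunctionalCalculus

/-! ### Quadratic maps preserve strict positivity -/

section Positivity

variable {A : Type*} [NormedNonAssocCommRing A] [NormedSpace ℝ A] [UnitalJBAlgebra A]

theorem StrictPos.pos_of_mem_spec {a : A} (ha : StrictPos a) {r : ℝ} (hr : r ∈ spec a) : 0 < r := by
  by_contra! h
  apply hr
  rcases h.eq_or_lt with rfl | h
  · rw [zero_smul, sub_zero]; exact ha.isInvertible
  · have := (ha.add (strictPos_smul_one (neg_pos.mpr h))).isInvertible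
    rwa [neg_smul, ← sub_eq_add_neg] at this

theorem strictPos_of_spec {a : A} (h : ∀ r ∈ spec a, 0 < r) : StrictPos a := by
  obtain ⟨Φ, hΦ, hn⟩ := exists_isFunctionalCalculus a
  set i : C(spec a, ℝ) := ⟨fun x => (x : ℝ), continuous_subtype_val⟩
  have hi : Φ i = a := hΦ.map_id
  have h1 : Φ 1 = 1 := hΦ.map_one
  have hK : 0 < ‖i‖ + 1 := by positivity
  refine ⟨‖i‖ + 1, ?_⟩
  calc ‖(‖i‖ + 1) • (1 : A) - a‖ = ‖Φ ((‖i‖ + 1) • (1 : C(spec a, ℝ)) - i)‖ := by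
        rw [map_sub, map_smul, h1, hi]
    _ ≤ ‖(‖i‖ + 1) • (1 : C(spec a, ℝ)) - i‖ := hn _
    _ < ‖i‖ + 1 := by
      rw [ContinuousMap.norm_lt_iff _ hK]
      intro t
      have h2 : ‖i t‖ ≤ ‖i‖ := i.norm_coe_le_norm t
      have h3 : 0 < i t := h t t.2
      rw [Real.norm_of_nonneg h3.le] at h2
      simp only [ContinuousMap.sub_apply, ContinuousMap.smul_apply, ContinuousMap.one_apply,
        smul_eq_mul, mul_one, Real.norm_eq_abs]
      rw [abs_lt]
      constructor <;> linarith

theorem Positive.strictPos {a : A} (h : Positive a) (h' : IsInvertible a) : StrictPos a := by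
  refine strictPos_of_spec fun r hr => lt_of_le_of_ne (h hr) ?_
  rintro rfl
  apply hr
  rwa [zero_smul, sub_zero]

theorem strictPos_of_forall_add {a : A} (h : ∀ δ > (0 : ℝ), StrictPos (a + δ • (1 : A)))
    (h' : IsInvertible a) : StrictPos a := by
  refine Positive.strictPos (fun r hr => ?_) h'
  by_contra hneg
  apply hr
  have := (h (-r) (neg_pos.mpr (not_le.mp hneg))).isInvertible
  rwa [neg_smul, ← sub_eq_add_neg] at this

theorem IsInvertible.strictPos_mul_self {a : A} (ha : IsInvertible a) : StrictPos (a * a) := by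
  refine strictPos_of_forall_add (fun δ hδ => ?_) ?_
  · have := (isJBNorm_generated a).strictPos_mul_self_add (polyEvalGen a Polynomial.X) hδ
    obtain ⟨K, hK⟩ := this
    refine ⟨K, ?_⟩
    change ‖K • (1 : A) - (polyEval a Polynomial.X * polyEval a Polynomial.X + δ • (1 : A))‖ < K
      at hK
    rwa [polyEval_X] at hK
  · obtain ⟨b, hb⟩ := ha
    have := hb.U isInverse_one_one
    rw [U_one_right] at this
    exact ⟨_, this⟩

/-- For invertible `x` the operator `U_x` preserves strict positivity: it maps the segment
from `1` to `y` into the invertible elements, in which the strictly positive ones are open and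
closed, and `U_x 1 = x²` is strictly positive. -/
theorem StrictPos.U {x y : A} (hx : IsInvertible x) (hy : StrictPos y) : StrictPos (U x y) := by
  set c : ℝ → A := fun τ => UCLM x ((1 - τ) • (1 : A) + τ • y) with hc
  have hcont : Continuous c := by fun_prop
  set u : Set ℝ := {τ | StrictPos (c τ)}
  have hu : IsOpen u := isOpen_strictPos.preimage hcont
  have hinv (τ : ℝ) (hτ : τ ∈ Set.Icc (0 : ℝ) 1) : IsInvertible (c τ) := by
    have hs : StrictPos ((1 - τ) • (1 : A) + τ • y) := by
      rcases hτ.1.eq_or_lt with rfl | h0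
      · simpa using strictPos_smul_one (E := A) one_pos
      rcases hτ.2.eq_or_lt with rfl | h1
      · simpa using hy
      · exact (strictPos_smul_one (sub_pos.mpr h1)).add (hy.smul h0)
    obtain ⟨x', hx'⟩ := hx
    obtain ⟨z, hz⟩ := hs.isInvertible
    have := hx'.U hz
    rw [← UCLM_apply] at this
    exact ⟨_, this⟩
  have h0 : (0 : ℝ) ∈ u := by
    change StrictPos (c 0)
    simp only [hc, sub_zero, one_smul, zero_smul, add_zero, UCLM_apply, U_one_right]
    exact hx.strictPos_mul_self
  have hclosed : closure u ∩ Set.Icc 0 1 ⊆ u := by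
    rintro τ ⟨hτ, hτ'⟩
    refine strictPos_of_forall_add (fun δ hδ => ?_) (hinv τ hτ')
    have hmem : c τ ∈ closure {z : A | StrictPos z} :=
      map_mem_closure hcont hτ fun σ hσ => hσ
    obtain ⟨w, hw, hdist⟩ := Metric.mem_closure_iff.mp hmem δ hδ
    rw [dist_comm, dist_eq_norm] at hdist
    have := StrictPos.add hw (strictPos_smul_one_sub hdist)
    rwa [show w + (δ • (1 : A) - (w - c τ)) = c τ + δ • (1 : A) by module] at this
  have hsub := isPreconnected_Icc.subset_of_closure_inter_subset hu
    ⟨0, Set.left_mem_Icc.mpr zero_le_one, h0⟩ hclosed (Set.right_mem_Icc.mpr zero_le_one)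
  have h1 : c 1 = JB.U x y := by
    simp only [hc, sub_self, zero_smul, one_smul, zero_add, UCLM_apply]
  rw [← h1]
  exact hsub

end Positivity

/-! ### The scalar integral -/

section ScalarIntegral

theorem ofReal_beta_integrand (s : ℝ) {t : ℝ} (ht : t ∈ Set.Ioc (0 : ℝ) 1) :
    (t : ℂ) ^ ((s : ℂ) - 1) * (1 - (t : ℂ)) ^ ((1 - s : ℂ) - 1) =
      ((t ^ (s - 1) * (1 - t) ^ (-s) : ℝ) : ℂ) := by
  rw [Complex.ofReal_mul, Complex.ofReal_cpow ht.1.le, Complex.ofReal_cpow (by linarith [ht.2])]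
  push_cast
  ring_nf

theorem intervalIntegrable_beta {s : ℝ} (hs : s ∈ Set.Ioo (0 : ℝ) 1) :
    IntervalIntegrable (fun t : ℝ => t ^ (s - 1) * (1 - t) ^ (-s)) volume 0 1 := by
  have h := Complex.betaIntegral_convergent (u := s) (v := 1 - s) (by simpa using hs.1)
    (by simpa using hs.2)
  rw [intervalIntegrable_iff_integrableOn_Ioc_of_le zero_le_one] at h ⊢
  have h2 := h.re
  refine h2.congr ((ae_restrict_iff' measurableSet_Ioc).mpr (Filter.Eventually.of_forall ?_))
  intro t ht
  simp only [ofReal_beta_integrand s ht]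
  exact Complex.ofReal_re _

theorem integral_beta {s : ℝ} (hs : s ∈ Set.Ioo (0 : ℝ) 1) :
    ∫ t in (0 : ℝ)..1, t ^ (s - 1) * (1 - t) ^ (-s) = Real.pi / Real.sin (Real.pi * s) := by
  have h1 : Complex.betaIntegral s (1 - s) =
      ((∫ t in (0 : ℝ)..1, t ^ (s - 1) * (1 - t) ^ (-s) : ℝ) : ℂ) := by
    rw [Complex.betaIntegral, ← intervalIntegral.integral_ofReal]
    refine intervalIntegral.integral_congr_ae (Filter.Eventually.of_forall fun t ht => ?_)
    rw [Set.uIoc_of_le zero_le_one] at ht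
    exact ofReal_beta_integrand s ht
  have h2 := Complex.Gamma_mul_Gamma_eq_betaIntegral (s := s) (t := 1 - s)
    (by simpa using hs.1) (by simpa using hs.2)
  rw [add_sub_cancel, Complex.Gamma_one, one_mul, h1, Complex.Gamma_mul_Gamma_one_sub] at h2
  exact_mod_cast h2.symm

/-- At `t = 1` the identity rests on the conventions `1 / 0 = 0` and `0⁻¹ = 0`. -/
theorem div_one_sub_rpow (s : ℝ) {t : ℝ} (ht : t ∈ Set.Ioc (0 : ℝ) 1) :
    (t / (1 - t)) ^ s = t * (t ^ (s - 1) * (1 - t) ^ (-s)) := by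
  have h1 : 0 ≤ 1 - t := by linarith [ht.2]
  rw [Real.div_rpow ht.1.le h1, Real.rpow_neg h1, Real.rpow_sub_one ht.1.ne', ← mul_assoc,
    mul_div_cancel₀ _ ht.1.ne', div_eq_mul_inv]

theorem intervalIntegrable_div_one_sub_rpow {s : ℝ} (hs : s ∈ Set.Ioo (0 : ℝ) 1) :
    IntervalIntegrable (fun t : ℝ => (t / (1 - t)) ^ s) volume 0 1 := by
  refine ((intervalIntegrable_beta hs).continuousOn_mul continuousOn_id).congr ?_
  intro t ht
  rw [Set.uIoc_of_le zero_le_one] at ht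
  exact (div_one_sub_rpow s ht).symm

/-- The substitution `v = t / ((1 - t) c + t)` of the unit interval transforms the Beta integral
of the parameters `s` and `1 - s` into the one on the left. -/
theorem setIntegral_beta_mul_div {s c : ℝ} (hc : 0 < c) :
    ∫ t in Set.Ioo (0 : ℝ) 1, t ^ (s - 1) * (1 - t) ^ (-s) * (c / ((1 - t) * c + t)) =
      c ^ s * ∫ t in Set.Ioo (0 : ℝ) 1, t ^ (s - 1) * (1 - t) ^ (-s) := by
  have hD {t : ℝ} (ht : t ∈ Set.Ioo (0 : ℝ) 1) : 0 < (1 - t) * c + t :=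
    add_pos (mul_pos (sub_pos.mpr ht.2) hc) ht.1
  set f : ℝ → ℝ := fun t => t / ((1 - t) * c + t) with hf
  have hderiv (t : ℝ) (ht : t ∈ Set.Ioo (0 : ℝ) 1) :
      HasDerivWithinAt f (c / ((1 - t) * c + t) ^ 2) (Set.Ioo 0 1) t := by
    have h1 : HasDerivAt (fun t : ℝ => (1 - t) * c + t) (-1 * c + 1) t :=
      (((hasDerivAt_id t).const_sub 1).mul_const c).add (hasDerivAt_id t)
    have h2 := (hasDerivAt_id t).div h1 (hD ht).ne'
    refine (h2.congr_deriv ?_).hasDerivWithinAt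
    simp only [id]
    congr 1
    ring
  have hinj : Set.InjOn f (Set.Ioo 0 1) := by
    intro t ht u hu h
    rw [hf] at h
    have h' := (div_eq_div_iff (hD ht).ne' (hD hu).ne').mp h
    have : c * (t - u) = 0 := by linear_combination h'
    rcases mul_eq_zero.mp this with h0 | h0
    · exact absurd h0 hc.ne'
    · linarith
  have himage : f '' Set.Ioo 0 1 = Set.Ioo 0 1 := by
    ext v
    constructor
    · rintro ⟨t, ht, rfl⟩
      refine ⟨div_pos ht.1 (hD ht), (div_lt_one (hD ht)).mpr ?_⟩
      have := mul_pos (sub_pos.mpr ht.2) hc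
      linarith
    · intro hv
      have h1 : 0 < 1 - v + v * c := add_pos (sub_pos.mpr hv.2) (mul_pos hv.1 hc)
      refine ⟨v * c / (1 - v + v * c), ⟨div_pos (mul_pos hv.1 hc) h1, (div_lt_one h1).mpr ?_⟩, ?_⟩
      · linarith [hv.2]
      · have h2 : (1 - v * c / (1 - v + v * c)) * c + v * c / (1 - v + v * c) =
            c / (1 - v + v * c) := by field_simp; ring
        rw [hf]
        simp only [h2]
        field_simp
  have hsub := integral_image_eq_integral_abs_deriv_smul measurableSet_Ioo hderiv hinj
    (fun v => v ^ (s - 1) * (1 - v) ^ (-s))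
  rw [himage] at hsub
  rw [hsub, ← integral_const_mul]
  refine setIntegral_congr_fun measurableSet_Ioo fun t ht => ?_
  have hDt := hD ht
  have h1t : 0 < 1 - t := sub_pos.mpr ht.2
  simp only [hf, smul_eq_mul]
  rw [abs_of_pos (by positivity), show 1 - t / ((1 - t) * c + t) =
    ((1 - t) * c) / ((1 - t) * c + t) by field_simp; ring]
  rw [Real.div_rpow ht.1.le hDt.le, Real.div_rpow (by positivity) hDt.le,
    Real.mul_rpow h1t.le hc.le, Real.rpow_neg hc.le, Real.rpow_neg hDt.le,
    Real.rpow_sub_one hDt.ne']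
  have h2 := (Real.rpow_pos_of_pos hc s).ne'
  have h3 := (Real.rpow_pos_of_pos hDt s).ne'
  field_simp

theorem integral_div_one_sub_rpow_mul {s c : ℝ} (hs : s ∈ Set.Ioo (0 : ℝ) 1) (hc : 0 < c) :
    ∫ t in (0 : ℝ)..1, (t / (1 - t)) ^ s * ((c - 1) / ((1 - t) * c + t)) =
      Real.pi / Real.sin (Real.pi * s) * (c ^ s - 1) := by
  have hD {t : ℝ} (ht : t ∈ Set.Icc (0 : ℝ) 1) : 0 < (1 - t) * c + t := by
    rcases ht.1.eq_or_lt with rfl | h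
    · simpa
    · exact add_pos_of_nonneg_of_pos (mul_nonneg (sub_nonneg.mpr ht.2) hc.le) h
  have h1 : ∫ t in (0 : ℝ)..1, (t / (1 - t)) ^ s * ((c - 1) / ((1 - t) * c + t)) =
      ∫ t in (0 : ℝ)..1, (t ^ (s - 1) * (1 - t) ^ (-s) * (c / ((1 - t) * c + t)) -
        t ^ (s - 1) * (1 - t) ^ (-s)) := by
    refine intervalIntegral.integral_congr_ae (Filter.Eventually.of_forall fun t ht => ?_)
    rw [Set.uIoc_of_le zero_le_one] at ht
    have := hD ⟨ht.1.le, ht.2⟩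
    rw [div_one_sub_rpow s ht]
    generalize t ^ (s - 1) * (1 - t) ^ (-s) = w
    generalize hDt : (1 - t) * c + t = D at this ⊢
    field_simp
    linear_combination -w * hDt
  have hcont : ContinuousOn (fun t : ℝ => c / ((1 - t) * c + t)) (Set.uIcc 0 1) := by
    rw [Set.uIcc_of_le zero_le_one]
    exact continuousOn_const.div (by fun_prop) fun t ht => (hD ht).ne'
  rw [h1, intervalIntegral.integral_sub ((intervalIntegrable_beta hs).mul_continuousOn hcont)
    (intervalIntegrable_beta hs), ← integral_beta hs]
  simp only [intervalIntegral.integral_of_le zero_le_one, integral_Ioc_eq_integral_Ioo]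
  rw [setIntegral_beta_mul_div hc]
  ring

end ScalarIntegral

/-! ### Means and the Tsallis entropy -/

section Means

variable {A : Type*} [NormedNonAssocCommRing A] [NormedSpace ℝ A] [UnitalJBAlgebra A]

theorem IsInverse.symm {a b : A} (h : IsInverse a b) : IsInverse b a :=
  isInverse_of_U (T := UCLM a) (fun z => by rw [UCLM_apply, h.U_U]) (by
    conv_lhs => rw [← h.U_apply, h.U_U'])

theorem isInverse_power_half {a : A} (ha : StrictPos a) :
    IsInverse (power a (1 / 2)) (power a (-(1 / 2))) ∧
      power a (1 / 2) * power a (1 / 2) = a := by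
  obtain ⟨Φ, hΦ, hfc⟩ := exists_fc_eq a
  have hpos (t : spec a) : 0 < (t : ℝ) := ha.pos_of_mem_spec t.2
  have hcont (r : ℝ) : ContinuousOn (fun x : ℝ => x ^ r) (spec a) := fun x hx =>
    (Real.continuousAt_rpow_const x r (Or.inl (ha.pos_of_mem_spec hx).ne')).continuousWithinAt
  rw [power, power, hfc _ (hcont _), hfc _ (hcont _)]
  constructor
  · refine hΦ.isInverse ?_
    ext t
    change (t : ℝ) ^ (1 / 2 : ℝ) * (t : ℝ) ^ (-(1 / 2) : ℝ) = 1
    rw [← Real.rpow_add (hpos t), add_neg_cancel, Real.rpow_zero]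
  · rw [← hΦ.map_mul]
    refine Eq.trans ?_ hΦ.map_id
    congr 1
    ext t
    change (t : ℝ) ^ (1 / 2 : ℝ) * (t : ℝ) ^ (1 / 2 : ℝ) = t
    rw [← Real.rpow_add (hpos t), add_halves, Real.rpow_one]

theorem one_sub_mul_add_pos {t x : ℝ} (ht : t ∈ Set.Icc (0 : ℝ) 1) (hx : 0 < x) :
    0 < (1 - t) * x + t := by
  rcases ht.1.eq_or_lt with rfl | h
  · simpa
  · exact add_pos_of_nonneg_of_pos (mul_nonneg (sub_nonneg.mpr ht.2) hx.le) h

/-- The function `x ↦ (x - 1) / ((1 - t) x + t)` on the spectrum of a strictly positive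
element. -/
noncomputable def harmonicKernel {c : A} (hc : StrictPos c) (t : Set.Icc (0 : ℝ) 1) :
    C(spec c, ℝ) where
  toFun x := (x - 1) / ((1 - t) * x + t)
  continuous_toFun := Continuous.div (by fun_prop) (by fun_prop) fun x =>
    (one_sub_mul_add_pos t.2 (hc.pos_of_mem_spec x.2)).ne'

theorem continuous_harmonicKernel {c : A} (hc : StrictPos c) : Continuous (harmonicKernel hc) := by
  refine ContinuousMap.continuous_of_continuous_uncurry _ ?_
  change Continuous fun p : Set.Icc (0 : ℝ) 1 × spec c =>
    ((p.2 : ℝ) - 1) / ((1 - (p.1 : ℝ)) * p.2 + p.1)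
  exact Continuous.div (by fun_prop) (by fun_prop) fun p =>
    (one_sub_mul_add_pos p.1.2 (hc.pos_of_mem_spec p.2.2)).ne'

/-- Since inversion intertwines `U_a` and `U_{a⁻¹}`, the harmonic mean of `a²` and `U_a c` is `U_a`
applied to a function of `c`. -/
theorem inv_smul_harmonicMean_sub {a a' c : A} (ha : IsInverse a a') (hc : StrictPos c)
    {Φ : C(spec c, ℝ) →ₗ[ℝ] A} (hΦ : IsFunctionalCalculus c Φ) (t : Set.Icc (0 : ℝ) 1)
    (ht : (t : ℝ) ≠ 0) :
    (t : ℝ)⁻¹ • (harmonicMean t (a * a) (U a c) - a * a) = U a (Φ (harmonicKernel hc t)) := by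
  have hpos (x : spec c) : 0 < (x : ℝ) := hc.pos_of_mem_spec x.2
  have hD (x : spec c) : 0 < (1 - (t : ℝ)) * x + t := one_sub_mul_add_pos t.2 (hpos x)
  set i : C(spec c, ℝ) := ⟨fun x => (x : ℝ), continuous_subtype_val⟩
  set v : C(spec c, ℝ) := ⟨fun x => (x : ℝ)⁻¹, continuous_subtype_val.inv₀ fun x => (hpos x).ne'⟩
  set h : C(spec c, ℝ) := ⟨fun x => x / ((1 - (t : ℝ)) * x + t),
    Continuous.div (by fun_prop) (by fun_prop) fun x => (hD x).ne'⟩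
  have hiv : i * v = 1 := by
    ext x
    exact mul_inv_cancel₀ (hpos x).ne'
  have hkh : ((1 - (t : ℝ)) • (1 : C(spec c, ℝ)) + (t : ℝ) • v) * h = 1 := by
    ext x
    have hx := (hpos x).ne'
    have hDx := (hD x).ne'
    change ((1 - (t : ℝ)) * 1 + t * (x : ℝ)⁻¹) * (x / ((1 - (t : ℝ)) * x + t)) = 1
    field_simp
  have hker : harmonicKernel hc t = (t : ℝ)⁻¹ • (h - 1) := by
    ext x
    have hDx := (hD x).ne'
    change ((x : ℝ) - 1) / ((1 - t) * x + t) = (t : ℝ)⁻¹ * (x / ((1 - (t : ℝ)) * x + t) - 1)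
    generalize hE : (1 - (t : ℝ)) * x + t = E at hDx ⊢
    field_simp
    linear_combination -hE
  have hA : inverse (a * a) = U a' 1 := by
    have := (ha.U isInverse_one_one).inverse_eq
    rwa [U_one_right a] at this
  have hB : inverse (U a c) = U a' (Φ v) := by
    have h1 : Φ i = c := hΦ.map_id
    have h2 : IsInverse c (Φ v) := by
      have := hΦ.isInverse hiv
      rwa [h1] at this
    exact (ha.U h2).inverse_eq
  have hsum : (1 - (t : ℝ)) • U a' 1 + (t : ℝ) • U a' (Φ v) =
      U a' (Φ ((1 - (t : ℝ)) • (1 : C(spec c, ℝ)) + (t : ℝ) • v)) := by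
    simp only [← UCLM_apply, map_add, map_smul, hΦ.map_one]
  rw [harmonicMean, hA, hB, hsum, (ha.symm.U (hΦ.isInverse hkh)).inverse_eq, hker, map_smul,
    map_sub, hΦ.map_one, ← U_one_right a]
  simp only [← UCLM_apply, map_sub, map_smul]

theorem integral_smul_harmonicKernel {c : A} (hc : StrictPos c) {s : ℝ}
    (hs : s ∈ Set.Ioo (0 : ℝ) 1) (p : C(spec c, ℝ)) (hp : ∀ x : spec c, p x = (x : ℝ) ^ s) :
    ∫ t in (0 : ℝ)..1, (t / (1 - t)) ^ s •
        harmonicKernel hc (Set.projIcc 0 1 zero_le_one t) =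
      (Real.pi / Real.sin (Real.pi * s)) • (p - 1) := by
  ext x
  have hint : IntervalIntegrable (fun t : ℝ => (t / (1 - t)) ^ s •
      harmonicKernel hc (Set.projIcc 0 1 zero_le_one t)) volume 0 1 :=
    (intervalIntegrable_div_one_sub_rpow hs).smul_continuousOn
      ((continuous_harmonicKernel hc).comp continuous_projIcc).continuousOn
  have heval := (ContinuousMap.evalCLM ℝ x).intervalIntegral_comp_comm hint
  simp only [ContinuousMap.evalCLM_apply] at heval
  rw [← heval, ContinuousMap.smul_apply, ContinuousMap.sub_apply, ContinuousMap.one_apply, hp,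
    smul_eq_mul, ← integral_div_one_sub_rpow_mul hs (hc.pos_of_mem_spec x.2)]
  refine intervalIntegral.integral_congr fun t ht => ?_
  rw [Set.uIcc_of_le zero_le_one] at ht
  simp only [Set.projIcc_of_mem zero_le_one ht]
  rfl

end Means

end JB

theorem mainTheorem7 {𝓐 : Type*} [JB.NormedNonAssocCommRing 𝓐] [NormedSpace ℝ 𝓐]
    [JB.UnitalJBAlgebra 𝓐] (A B : 𝓐)
    (hA : JB.Positive A) (hA' : JB.IsInvertible A) (hB : JB.Positive B) (hB' : JB.IsInvertible B)
    (s : ℝ) (hs : s ∈ Set.Ioo (0 : ℝ) 1) :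
    IntervalIntegrable
        (fun t : ℝ => (t / (1 - t)) ^ s • (t⁻¹ • (JB.harmonicMean t A B - A))) volume 0 1 ∧
      JB.tsallisEntropy s A B =
        (Real.sin (s * Real.pi) / (s * Real.pi)) •
          ∫ t in (0 : ℝ)..1, (t / (1 - t)) ^ s • (t⁻¹ • (JB.harmonicMean t A B - A)) := by
  obtain ⟨ha, haa⟩ := JB.isInverse_power_half (hA.strictPos hA')
  set a := JB.power A (1 / 2)
  set c := JB.U (JB.power A (-(1 / 2))) B
  have hc : JB.StrictPos c := JB.StrictPos.U ⟨a, ha.symm⟩ (hB.strictPos hB')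
  have hac : JB.U a c = B := ha.U_U B
  obtain ⟨Φ, hΦ, hfc⟩ := JB.exists_fc_eq c
  set p : C(JB.spec c, ℝ) := ⟨fun x => (x : ℝ) ^ s, Continuous.rpow_const continuous_subtype_val
    fun x => Or.inl (hc.pos_of_mem_spec x.2).ne'⟩
  have hpow : JB.power c s = Φ p :=
    hfc _ fun x _ => (Real.continuousAt_rpow_const x s (Or.inr hs.1.le)).continuousWithinAt
  let L : C(JB.spec c, ℝ) →L[ℝ] 𝓐 := (JB.UCLM a).comp ⟨Φ, hΦ.continuous⟩
  have hL (f : C(JB.spec c, ℝ)) : L f = JB.U a (Φ f) := JB.UCLM_apply a (Φ f)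
  set G : ℝ → C(JB.spec c, ℝ) := fun t => JB.harmonicKernel hc (Set.projIcc 0 1 zero_le_one t)
  have hG : Continuous G := (JB.continuous_harmonicKernel hc).comp continuous_projIcc
  have hint : IntervalIntegrable (fun t : ℝ => (t / (1 - t)) ^ s • G t) volume 0 1 :=
    (JB.intervalIntegrable_div_one_sub_rpow hs).smul_continuousOn hG.continuousOn
  have hintL : IntervalIntegrable (fun t : ℝ => (t / (1 - t)) ^ s • L (G t)) volume 0 1 :=
    (JB.intervalIntegrable_div_one_sub_rpow hs).smul_continuousOn
      (L.continuous.comp hG).continuousOn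
  have hcongr : Set.EqOn (fun t : ℝ => (t / (1 - t)) ^ s • L (G t))
      (fun t : ℝ => (t / (1 - t)) ^ s • (t⁻¹ • (JB.harmonicMean t A B - A))) (Set.uIoc 0 1) := by
    intro t ht
    rw [Set.uIoc_of_le zero_le_one] at ht
    have ht' : t ∈ Set.Icc (0 : ℝ) 1 := ⟨ht.1.le, ht.2⟩
    have h := JB.inv_smul_harmonicMean_sub ha hc hΦ ⟨t, ht'⟩ ht.1.ne'
    rw [haa, hac] at h
    simp only [hL, h, G, Set.projIcc_of_mem zero_le_one ht']
  refine ⟨hintL.congr hcongr, ?_⟩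
  rw [← intervalIntegral.integral_congr_ae (Filter.Eventually.of_forall hcongr)]
  simp only [← map_smul]
  rw [L.intervalIntegral_comp_comm hint, JB.integral_smul_harmonicKernel hc hs p fun _ => rfl]
  have hsin : Real.sin (Real.pi * s) ≠ 0 :=
    (Real.sin_pos_of_pos_of_lt_pi (mul_pos Real.pi_pos hs.1)
      (mul_lt_of_lt_one_right Real.pi_pos hs.2)).ne'
  have hgeo : JB.geometricMean s A B - A = L (p - 1) := by
    rw [map_sub, hL, hL, hΦ.map_one, JB.U_one_right, haa, ← hpow]
    rfl
  rw [JB.tsallisEntropy, hgeo, map_smul, smul_smul]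
  congr 1
  have hs0 := hs.1.ne'
  have hpi := Real.pi_ne_zero
  rw [mul_comm s Real.pi]
  generalize Real.sin (Real.pi * s) = σ at hsin ⊢
  field_simp
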